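/- Let $|G_{1,2}\rangle=\frac{1}{\sqrt2}(|000\rangle\pm|111\rangle)$, $|G_{3,4}\rangle=\frac{1}{\sqrt2}(|001\rangle\pm|110\rangle)$, $|G_{5,6}\rangle=\frac{1}{\sqrt2}(|010\rangle\pm|101\rangle)$, $|G_{7,8}\rangle=\frac{1}{\sqrt2}(|100\rangle\pm|011\rangle)$ be the eight three-qubit GHZ-basis states, the three qubits of each state being held by three different parties. For a set $T\subseteq\{1,\dots,8\}$ with $|T|=D$ and a $k$-element subset $S=\{\alpha_1,\dots,\alpha_k\}\subseteq T$ let $$\rho_S=\frac{1}{k!}\sum_{\pi\in \mathfrak S_k}|\Phi_\pi\rangle\langle\Phi_\pi|,\qquad |\Phi_\pi\rangle=|G_{\alpha_{\pi(1)}}\rangle\otimes\cdots\otimes|G_{\alpha_{\pi(k)}}\rangle,$$ be the state shared by the parties when the $k$ states of $S$ are distributed among them in an unknown order (each party then holds $k$ qubits). Given a distribution of the three parties over separated labs, the set $\{|G_\alpha\rangle\}_{\alpha\in T}$ is called locally $(D,k)$-identifiable if there is a measurement, implementable by local operations in the labs and classical communication between them (LOCC; limits of finite-round protocols are allowed), which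 for every $k$-element subset $S\subseteq T$ outputs $S$ with probability one on $\rho_S$; otherwise it is locally $(D,k)$-unidentifiable. Let $2<D\le 8$ and $1<k<D$ with $\binom{D}{k}>2^{2k}$. Then any $D$ of the eight GHZ-basis states form a locally $(D,k)$-unidentifiable set, both when the three parties are in three separated labs and when any two of the three parties join in one lab, i.e. across every one of the three bipartitions. -/

import Mathlib

open scoped Matrix

noncomputable section

namespace LSI

/-- A linear operator that a lab has applied so far to its share of the state: a matrix from the
initial local space `ℂ^ι` to the present local space `ℂ^out`.  The output space may be any
finite-dimensional space, so local ancillas and partial traces are allowed. -/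
structure LocalOp (ι : Type) where
  out : Type
  fintypeOut : Fintype out
  decOut : DecidableEq out
  mat : Matrix out ι ℂ

attribute [instance] LocalOp.fintypeOut LocalOp.decOut

/-- The identity operator: nothing has been done yet. -/
abbrev LocalOp.one (ι : Type) [Fintype ι] [DecidableEq ι] : LocalOp ι := ⟨ι, ‹_›, ‹_›, 1⟩

section LOCC

variable {L : Type} [DecidableEq L] {ι : L → Type}

/-- A finite-round LOCC protocol with final classical output in `O`, among labs `L` with initial
local spaces `ℂ^(ι ℓ)`, continued from the situation where lab `ℓ` has applied `A ℓ`.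
Either the labs announce an output, or one lab `ℓ` performs a local measurement with Kraus
operators `K j` on its present system and broadcasts the outcome `j`; the rest of the protocol
may depend on `j`. -/
inductive Protocol (O : Type) : (∀ ℓ, LocalOp (ι ℓ)) → Type 1
  | output {A : ∀ ℓ, LocalOp (ι ℓ)} (o : O) : Protocol O A
  | measure {A : ∀ ℓ, LocalOp (ι ℓ)} (ℓ : L) (r : ℕ)
      (κ : Fin r → Type) (fκ : ∀ j, Fintype (κ j)) (dκ : ∀ j, DecidableEq (κ j))
      (K : ∀ j, Matrix (κ j) (A ℓ).out ℂ)
      (complete : ∑ j, (K j)ᴴ * K j = 1)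
      (next : ∀ j, Protocol O
        (Function.update A ℓ ⟨κ j, fκ j, dκ j, K j * (A ℓ).mat⟩)) : Protocol O A

variable [Fintype L]

/-- The tensor product `⨂ ℓ, A ℓ` of the local operators. -/
def tensorOp (A : ∀ ℓ, LocalOp (ι ℓ)) : Matrix (∀ ℓ, (A ℓ).out) (∀ ℓ, ι ℓ) ℂ :=
  Matrix.of fun x y => ∏ ℓ, (A ℓ).mat (x ℓ) (y ℓ)

/-- The POVM element, on the initial joint space, of the output `o`: the sum of `Aᴴ A` over all
branches that end with output `o`, where `A` is the joint operator applied along the branch.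
On the initial state `ρ` the output is `o` with probability `tr (effect o * ρ)`. -/
def Protocol.effect {O : Type} [DecidableEq O] :
    {A : ∀ ℓ, LocalOp (ι ℓ)} → Protocol O A → O → Matrix (∀ ℓ, ι ℓ) (∀ ℓ, ι ℓ) ℂ
  | A, .output o', o => if o = o' then (tensorOp A)ᴴ * tensorOp A else 0
  | _, .measure _ _ _ _ _ _ _ next, o => ∑ j, (next j).effect o

variable (ι) [∀ ℓ, Fintype (ι ℓ)] [∀ ℓ, DecidableEq (ι ℓ)]

/-- The measurements with outcomes in `O` that finite-round LOCC protocols implement. -/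
def finiteLOCC (O : Type) [DecidableEq O] : Set (O → Matrix (∀ ℓ, ι ℓ) (∀ ℓ, ι ℓ) ℂ) :=
  Set.range fun P : Protocol O (fun ℓ => LocalOp.one (ι ℓ)) => P.effect

/-- The measurements available by LOCC.  Limits of finite-round protocols are included, so that
no protocol with infinitely many rounds is missed. -/
def LOCC (O : Type) [DecidableEq O] : Set (O → Matrix (∀ ℓ, ι ℓ) (∀ ℓ, ι ℓ) ℂ) :=
  closure (finiteLOCC ι O)

theorem finiteLOCC_subset_LOCC (O : Type) [DecidableEq O] : finiteLOCC ι O ⊆ LOCC ι O :=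
  subset_closure

end LOCC

section Identification

variable {P : Type} {β : P → Type} {L J : Type}

/-- Basis labels of the space held in lab `ℓ` when `k` systems are shared: the share of every
party `p` working in lab `ℓ` (`lab p = ℓ`) consists of `k` systems `ℂ^(β p)`. -/
abbrev LabSpace (β : P → Type) (lab : P → L) (k : ℕ) (ℓ : L) : Type :=
  ∀ p : {p : P // lab p = ℓ}, Fin k → β p

/-- The state vector `ψ (α 0) ⊗ ⋯ ⊗ ψ (α (k-1))`, the `i`-th factor living on the `i`-th system
of every party. -/
def productState (ψ : J → (∀ p, β p) → ℂ) (lab : P → L) {k : ℕ} (α : Fin k → J) :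
    (∀ ℓ, LabSpace β lab k ℓ) → ℂ :=
  fun x => ∏ i, ψ (α i) fun p => x (lab p) ⟨p, rfl⟩ i

/-- The state shared when the `k`-element subset `S` of states is distributed in an unknown order:
the uniform mixture of the product states over all `k!` orderings of `S`. -/
def subsetState [DecidableEq J] (ψ : J → (∀ p, β p) → ℂ) (lab : P → L) (k : ℕ) (S : Finset J) :
    Matrix (∀ ℓ, LabSpace β lab k ℓ) (∀ ℓ, LabSpace β lab k ℓ) ℂ :=
  ((k.factorial : ℂ))⁻¹ • ∑ e : Fin k ≃ S,
    Matrix.vecMulVec (productState ψ lab fun i => (e i : J))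
      (star (productState ψ lab fun i => (e i : J)))

/-- The set of states `{ψ j | j ∈ T}` is locally `(|T|, k)`-identifiable, the parties being
distributed over labs by `lab`: some LOCC measurement among the labs, given any `k`-element subset
`S` of `T` in unknown order, outputs `S` with probability one. -/
def IsIdentifiable [Fintype P] [DecidableEq P] [∀ p, Fintype (β p)] [∀ p, DecidableEq (β p)]
    [Fintype L] [DecidableEq L] [DecidableEq J]
    (ψ : J → (∀ p, β p) → ℂ) (T : Finset J) (k : ℕ) (lab : P → L) : Prop :=
  ∃ M ∈ LOCC (LabSpace β lab k) (Finset J),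
    ∀ S ⊆ T, S.card = k → (M S * subsetState ψ lab k S).trace = 1

end Identification

/-- Computational basis vectors of three qubits. -/
def ket (a b c : Fin 2) : (Fin 3 → Fin 2) → ℂ := Pi.single ![a, b, c] 1

/-- The eight three-qubit GHZ basis states. -/
def ghz : Fin 8 → (Fin 3 → Fin 2) → ℂ :=
  ![((√2 : ℝ) : ℂ)⁻¹ • (ket 0 0 0 + ket 1 1 1), ((√2 : ℝ) : ℂ)⁻¹ • (ket 0 0 0 - ket 1 1 1),
    ((√2 : ℝ) : ℂ)⁻¹ • (ket 0 0 1 + ket 1 1 0), ((√2 : ℝ) : ℂ)⁻¹ • (ket 0 0 1 - ket 1 1 0),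
    ((√2 : ℝ) : ℂ)⁻¹ • (ket 0 1 0 + ket 1 0 1), ((√2 : ℝ) : ℂ)⁻¹ • (ket 0 1 0 - ket 1 0 1),
    ((√2 : ℝ) : ℂ)⁻¹ • (ket 1 0 0 + ket 0 1 1), ((√2 : ℝ) : ℂ)⁻¹ • (ket 1 0 0 - ket 0 1 1)]

end LSI

end

/-!
The effects of an LOCC measurement are separable operators, that is, limits of sums of projectors
onto product vectors, and they sum to the identity; both properties survive limits of protocols.
If the nonzero squared Schmidt coefficients of a pure state across some cut of the labs are all
equal to `c`, then so is its largest possible overlap with a normalized product vector across the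
cut, whence `tr (E ρ) ≤ c * tr E` for every separable `E` and every mixture `ρ` of such states.
A separable measurement that identifies `N` such mixtures with certainty has total trace equal to
the dimension `d`, so `N ≤ c * d`. A GHZ state has two Schmidt coefficients `1 / √2` across each
proper cut, so a product of `k` of them has `c = 2⁻ᵏ`, while `d = 8ᵏ`: at most `4ᵏ` subsets can be
identified.
-/

namespace LSI

open Matrix

section PiKronecker

variable {L R : Type*} [Fintype L] {l m n : L → Type*}

/-- The Kronecker product `⨂ i, M i` of a finite family of matrices. -/
def piKronecker [CommMonoid R] (M : ∀ i, Matrix (m i) (n i) R) :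
    Matrix (∀ i, m i) (∀ i, n i) R :=
  of fun x y => ∏ i, M i (x i) (y i)

theorem piKronecker_mul_piKronecker [DecidableEq L] [CommSemiring R] [∀ i, Fintype (m i)]
    (M : ∀ i, Matrix (l i) (m i) R) (N : ∀ i, Matrix (m i) (n i) R) :
    piKronecker M * piKronecker N = piKronecker fun i => M i * N i := by
  ext x y
  simp only [mul_apply, piKronecker, of_apply, ← Finset.prod_mul_distrib]
  exact (Fintype.prod_sum fun i z => M i (x i) z * N i z (y i)).symm

theorem conjTranspose_piKronecker [CommSemiring R] [StarRing R]
    (M : ∀ i, Matrix (m i) (n i) R) :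
    (piKronecker M)ᴴ = piKronecker fun i => (M i)ᴴ := by
  ext x y
  simp only [conjTranspose_apply, piKronecker, of_apply, star_prod]

theorem piKronecker_one [CommSemiring R] [∀ i, DecidableEq (n i)] :
    piKronecker (fun i => (1 : Matrix (n i) (n i) R)) = 1 := by
  ext x y
  simp only [piKronecker, of_apply, one_apply, Finset.prod_ite_zero, Finset.prod_const_one,
    Finset.mem_univ, true_imp_iff, funext_iff]

theorem piKronecker_smul {S : Type*} [CommSemiring S] [CommSemiring R] [Algebra S R] (c : S)
    (M : ∀ i, Matrix (m i) (n i) R) :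
    piKronecker (fun i => c • M i) = c ^ Fintype.card L • piKronecker M := by
  ext x y
  simp only [piKronecker, of_apply, Matrix.smul_apply, Finset.prod_smul, Finset.prod_const,
    Finset.card_univ]

theorem piKronecker_update_apply [DecidableEq L] [CommMonoid R] (M : ∀ i, Matrix (m i) (n i) R)
    (i : L) (N : Matrix (m i) (n i) R) (x : ∀ i, m i) (y : ∀ i, n i) :
    piKronecker (Function.update M i N) x y =
      N (x i) (y i) * ∏ j ∈ Finset.univ \ {i}, M j (x j) (y j) := by
  have entry (j : L) : Function.update M i N j (x j) (y j) =
      Function.update (fun j => M j (x j) (y j)) i (N (x i) (y i)) j :=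
    Function.apply_update (fun j (B : Matrix (m j) (n j) R) => B (x j) (y j)) M i N j
  simp only [piKronecker, of_apply, entry, Finset.prod_update_of_mem (Finset.mem_univ i)]

theorem piKronecker_update_sum [DecidableEq L] [CommSemiring R] {κ : Type*} (s : Finset κ)
    (M : ∀ i, Matrix (m i) (n i) R) (i : L) (N : κ → Matrix (m i) (n i) R) :
    piKronecker (Function.update M i (∑ j ∈ s, N j)) =
      ∑ j ∈ s, piKronecker (Function.update M i (N j)) := by
  ext x y
  simp only [Matrix.sum_apply, piKronecker_update_apply, Finset.sum_mul]

end PiKronecker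

section ProductVectors

theorem conjTranspose_mul_self_eq_sum_vecMulVec {R m n : Type*} [Fintype m] [CommSemiring R]
    [StarRing R] (B : Matrix m n R) :
    Bᴴ * B = ∑ x, vecMulVec (star (B x)) (star (star (B x))) := by
  ext i j
  simp only [mul_apply, conjTranspose_apply, Matrix.sum_apply, vecMulVec_apply, Pi.star_apply,
    star_star]

theorem re_trace_vecMulVec_star {n : Type*} [Fintype n] (v : n → ℂ) :
    (vecMulVec v (star v)).trace.re = ∑ x, ‖v x‖ ^ 2 := by
  simp only [trace, diag_apply, vecMulVec_apply, Pi.star_apply, Complex.re_sum, Complex.star_def,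
    Complex.mul_conj', ← Complex.ofReal_pow, Complex.ofReal_re]

theorem re_trace_vecMulVec_star_mul_vecMulVec_star {n : Type*} [Fintype n] (v w : n → ℂ) :
    (vecMulVec v (star v) * vecMulVec w (star w)).trace.re = ‖star v ⬝ᵥ w‖ ^ 2 := by
  have swap : v ⬝ᵥ star w = star (star v ⬝ᵥ w) := by
    rw [star_dotProduct, star_star, dotProduct_comm]
  rw [vecMulVec_mul_vecMulVec, vecMulVec_smul, trace_smul, trace_vecMulVec, swap, smul_eq_mul,
    Complex.star_def, Complex.mul_conj', ← Complex.ofReal_pow, Complex.ofReal_re]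

variable {L : Type*} [Fintype L] {ι : L → Type*}

/-- The product vector `⨂ ℓ, a ℓ`. -/
def productVector (a : ∀ ℓ, ι ℓ → ℂ) : (∀ ℓ, ι ℓ) → ℂ :=
  fun x => ∏ ℓ, a ℓ (x ℓ)

theorem star_productVector (a : ∀ ℓ, ι ℓ → ℂ) :
    star (productVector a) = productVector fun ℓ => star (a ℓ) := by
  ext x
  simp only [Pi.star_apply, productVector, star_prod]

variable (ι) in
/-- The separable positive operators: the closed additive submonoid generated by the (unnormalized)
projectors onto product vectors.  Scalars need no separate generators, since a positive scalar can
be absorbed into a product vector. -/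
noncomputable def separableCone [∀ ℓ, Fintype (ι ℓ)] :
    AddSubmonoid (Matrix (∀ ℓ, ι ℓ) (∀ ℓ, ι ℓ) ℂ) :=
  (AddSubmonoid.closure (Set.range fun a : ∀ ℓ, ι ℓ → ℂ =>
    vecMulVec (productVector a) (star (productVector a)))).topologicalClosure

variable [DecidableEq L] [∀ ℓ, Fintype (ι ℓ)]

/-- `ρ` has expectation at most `c` in every normalized product vector; for a pure state this bounds
its overlap with product vectors, the quantity behind the geometric measure of entanglement. -/
def HasProductOverlapLE (c : ℝ) (ρ : Matrix (∀ ℓ, ι ℓ) (∀ ℓ, ι ℓ) ℂ) : Prop :=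
  ∀ a : ∀ ℓ, ι ℓ → ℂ,
    (vecMulVec (productVector a) (star (productVector a)) * ρ).trace.re ≤
      c * (vecMulVec (productVector a) (star (productVector a))).trace.re

theorem HasProductOverlapLE.re_trace_mul_le {c : ℝ} {E ρ : Matrix (∀ ℓ, ι ℓ) (∀ ℓ, ι ℓ) ℂ}
    (hρ : HasProductOverlapLE c ρ) (hE : E ∈ separableCone ι) :
    (E * ρ).trace.re ≤ c * E.trace.re := by
  have hclosed : IsClosed {E : Matrix (∀ ℓ, ι ℓ) (∀ ℓ, ι ℓ) ℂ |
      (E * ρ).trace.re ≤ c * E.trace.re} :=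
    isClosed_le
      (Complex.continuous_re.comp (continuous_id.matrix_mul continuous_const).matrix_trace)
      (continuous_const.mul (Complex.continuous_re.comp continuous_id.matrix_trace))
  refine closure_minimal (fun E hE => ?_) hclosed hE
  induction hE using AddSubmonoid.closure_induction with
  | mem _ h => obtain ⟨a, rfl⟩ := h; exact hρ a
  | zero => simp
  | add E F _ _ hE hF =>
    simp only [Set.mem_ofPred_eq, add_mul, trace_add, Complex.add_re, mul_add] at hE hF ⊢
    exact add_le_add hE hF

theorem re_trace_nonneg_of_mem_separableCone {E : Matrix (∀ ℓ, ι ℓ) (∀ ℓ, ι ℓ) ℂ}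
    (hE : E ∈ separableCone ι) : 0 ≤ E.trace.re := by
  have hzero : HasProductOverlapLE 1 (0 : Matrix (∀ ℓ, ι ℓ) (∀ ℓ, ι ℓ) ℂ) := fun a => by
    rw [mul_zero, trace_zero, Complex.zero_re, one_mul, re_trace_vecMulVec_star]
    positivity
  simpa using hzero.re_trace_mul_le hE

/-- Each outcome `o` costs at least `c⁻¹` of the total trace of the measurement. -/
theorem card_le_of_separable_discrimination [∀ ℓ, DecidableEq (ι ℓ)] {O : Type*} [Fintype O]
    {M ρ : O → Matrix (∀ ℓ, ι ℓ) (∀ ℓ, ι ℓ) ℂ} (hM : ∀ o, M o ∈ separableCone ι)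
    (hsum : ∑ o, M o = 1) {c : ℝ} (hc : 0 ≤ c) {s : Finset O}
    (hρ : ∀ o ∈ s, HasProductOverlapLE c (ρ o)) (hone : ∀ o ∈ s, (M o * ρ o).trace = 1) :
    (s.card : ℝ) ≤ c * Fintype.card (∀ ℓ, ι ℓ) :=
  calc (s.card : ℝ) = ∑ o ∈ s, (M o * ρ o).trace.re := by
        rw [Finset.sum_congr rfl fun o ho => by rw [hone o ho, Complex.one_re]]
        simp
    _ ≤ ∑ o ∈ s, c * (M o).trace.re :=
        Finset.sum_le_sum fun o ho => (hρ o ho).re_trace_mul_le (hM o)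
    _ ≤ ∑ o, c * (M o).trace.re :=
        Finset.sum_le_univ_sum_of_nonneg fun o =>
          mul_nonneg hc (re_trace_nonneg_of_mem_separableCone (hM o))
    _ = c * Fintype.card (∀ ℓ, ι ℓ) := by
        rw [← Finset.mul_sum, ← Complex.re_sum, ← trace_sum, hsum, trace_one, Complex.natCast_re]

end ProductVectors

section LOCC

variable {L : Type} [DecidableEq L] [Fintype L] {ι : L → Type} {O : Type} [DecidableEq O]

theorem tensorOp_gram (A : ∀ ℓ, LocalOp (ι ℓ)) :
    (tensorOp A)ᴴ * tensorOp A = piKronecker fun ℓ => (A ℓ).matᴴ * (A ℓ).mat := by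
  change (piKronecker fun ℓ => (A ℓ).mat)ᴴ * (piKronecker fun ℓ => (A ℓ).mat) = _
  rw [conjTranspose_piKronecker, piKronecker_mul_piKronecker]

theorem tensorOp_gram_update (A : ∀ ℓ, LocalOp (ι ℓ)) (ℓ : L) (B : LocalOp (ι ℓ)) :
    (tensorOp (Function.update A ℓ B))ᴴ * tensorOp (Function.update A ℓ B) =
      piKronecker (Function.update (fun ℓ => (A ℓ).matᴴ * (A ℓ).mat) ℓ (B.matᴴ * B.mat)) := by
  rw [tensorOp_gram]
  congr 1
  ext1 ℓ'
  exact Function.apply_update (fun _ (C : LocalOp _) => C.matᴴ * C.mat) A ℓ B ℓ'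

theorem sum_effect [Fintype O] {A : ∀ ℓ, LocalOp (ι ℓ)} (P : Protocol O A) :
    ∑ o, P.effect o = (tensorOp A)ᴴ * tensorOp A := by
  induction P with
  | output o' => simp [Protocol.effect]
  | @measure A ℓ r κ fκ dκ K complete next ih =>
    have local_sum : ∑ j, (K j * (A ℓ).mat)ᴴ * (K j * (A ℓ).mat) = (A ℓ).matᴴ * (A ℓ).mat := by
      simp only [conjTranspose_mul, Matrix.mul_assoc, ← Matrix.mul_sum]
      simp only [← Matrix.mul_assoc (K _)ᴴ, ← Matrix.sum_mul, complete, Matrix.one_mul]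
    simp only [Protocol.effect]
    rw [Finset.sum_comm]
    simp only [ih, tensorOp_gram_update]
    rw [← piKronecker_update_sum, local_sum, Function.update_eq_self, tensorOp_gram]

variable [∀ ℓ, Fintype (ι ℓ)]

theorem effect_mem_separableCone {A : ∀ ℓ, LocalOp (ι ℓ)} (P : Protocol O A) (o : O) :
    P.effect o ∈ separableCone ι := by
  induction P with
  | @output A o' =>
    rw [Protocol.effect]
    split_ifs
    · rw [conjTranspose_mul_self_eq_sum_vecMulVec]
      refine sum_mem fun x _ => AddSubmonoid.le_topologicalClosure _ (AddSubmonoid.subset_closure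
        ⟨fun ℓ => star ((A ℓ).mat (x ℓ)), ?_⟩)
      have row : star (tensorOp A x) = productVector fun ℓ => star ((A ℓ).mat (x ℓ)) :=
        star_productVector fun ℓ => (A ℓ).mat (x ℓ)
      rw [row]
    · exact zero_mem _
  | measure ℓ r κ fκ dκ K complete next ih =>
    rw [Protocol.effect]
    exact sum_mem fun j _ => ih j

variable [∀ ℓ, DecidableEq (ι ℓ)] {M : O → Matrix (∀ ℓ, ι ℓ) (∀ ℓ, ι ℓ) ℂ}

theorem mem_separableCone_of_mem_LOCC (hM : M ∈ LOCC ι O) (o : O) : M o ∈ separableCone ι := by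
  have hclosed : IsClosed {M : O → Matrix (∀ ℓ, ι ℓ) (∀ ℓ, ι ℓ) ℂ | M o ∈ separableCone ι} :=
    (AddSubmonoid.isClosed_topologicalClosure _).preimage (continuous_apply o)
  refine closure_minimal ?_ hclosed hM
  rintro _ ⟨P, rfl⟩
  exact effect_mem_separableCone P o

theorem sum_eq_one_of_mem_LOCC [Fintype O] (hM : M ∈ LOCC ι O) : ∑ o, M o = 1 := by
  have hclosed : IsClosed {M : O → Matrix (∀ ℓ, ι ℓ) (∀ ℓ, ι ℓ) ℂ | ∑ o, M o = 1} :=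
    isClosed_eq (continuous_finsetSum _ fun o _ => continuous_apply o) continuous_const
  refine closure_minimal ?_ hclosed hM
  rintro _ ⟨P, rfl⟩
  simp only [Set.mem_ofPred_eq, sum_effect, tensorOp_gram, conjTranspose_one, Matrix.one_mul,
    piKronecker_one]

end LOCC

section Bipartition

variable {P : Type*} {β : P → Type*} (s : P → Prop) [DecidablePred s]

/-- The coefficient matrix of a multipartite vector across the bipartition into the parties that
satisfy `s` and the others.  Its singular values are the Schmidt coefficients. -/
def cutMatrix (ψ : (∀ p, β p) → ℂ) : Matrix (∀ p : {p // s p}, β p) (∀ p : {p // ¬ s p}, β p) ℂ :=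
  of fun u v => ψ ((Equiv.piEquivPiSubtypeProd s β).symm (u, v))

variable [Fintype P]

/-- All nonzero squared Schmidt coefficients of `ψ` across the bipartition `s` are equal to `c`,
that is, its coefficient matrix is `√c` times a partial isometry. -/
def HasFlatSpectrum [DecidableEq P] [∀ p, Fintype (β p)] (c : ℝ) (ψ : (∀ p, β p) → ℂ) : Prop :=
  cutMatrix s ψ * (cutMatrix s ψ)ᴴ * cutMatrix s ψ = c • cutMatrix s ψ

variable {s}

theorem productVector_piEquivPiSubtypeProd_symm (a : ∀ p, β p → ℂ) (u : ∀ p : {p // s p}, β p)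
    (v : ∀ p : {p // ¬ s p}, β p) :
    productVector a ((Equiv.piEquivPiSubtypeProd s β).symm (u, v)) =
      productVector (fun p : {p // s p} => a p) u *
        productVector (fun p : {p // ¬ s p} => a p) v := by
  rw [productVector, ← Fintype.prod_subtype_mul_prod_subtype s]
  congr 1 <;> refine Finset.prod_congr rfl fun p _ => ?_ <;>
    simp [Equiv.piEquivPiSubtypeProd, p.2]

variable [DecidableEq P] [∀ p, Fintype (β p)]

section OperatorNorm

open scoped Matrix.Norms.L2Operator

theorem norm_dotProduct_mulVec_sq_le {m n : Type*} [Fintype m] [Fintype n] [DecidableEq n]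
    (M : Matrix m n ℂ) (f : m → ℂ) (g : n → ℂ) :
    ‖f ⬝ᵥ M *ᵥ g‖ ^ 2 ≤ ‖M‖ ^ 2 * ((∑ x, ‖f x‖ ^ 2) * ∑ y, ‖g y‖ ^ 2) := by
  have hinner : f ⬝ᵥ M *ᵥ g = inner ℂ (WithLp.toLp 2 (star f)) (WithLp.toLp 2 (M *ᵥ g)) := by
    rw [EuclideanSpace.inner_eq_star_dotProduct, star_star, dotProduct_comm]
  have hnorm : ‖f ⬝ᵥ M *ᵥ g‖ ≤ ‖WithLp.toLp 2 (star f)‖ * (‖M‖ * ‖WithLp.toLp 2 g‖) := by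
    rw [hinner]
    exact (norm_inner_le_norm _ _).trans
      (mul_le_mul_of_nonneg_left (l2_opNorm_mulVec M (WithLp.toLp 2 g)) (norm_nonneg _))
  calc ‖f ⬝ᵥ M *ᵥ g‖ ^ 2
      ≤ (‖WithLp.toLp 2 (star f)‖ * (‖M‖ * ‖WithLp.toLp 2 g‖)) ^ 2 := by gcongr
    _ = ‖M‖ ^ 2 * ((∑ x, ‖f x‖ ^ 2) * ∑ y, ‖g y‖ ^ 2) := by
      simp only [mul_pow, EuclideanSpace.norm_sq_eq, Pi.star_apply, norm_star]
      ring

theorem l2_opNorm_sq_le_of_mul_conjTranspose_mul_self {m n : Type*} [Fintype m] [Fintype n]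
    [DecidableEq n] {M : Matrix m n ℂ} {c : ℝ} (hc : 0 ≤ c) (hM : M * Mᴴ * M = c • M) :
    ‖M‖ ^ 2 ≤ c := by
  have gram_sq : (Mᴴ * M)ᴴ * (Mᴴ * M) = c • (Mᴴ * M) := by
    rw [conjTranspose_mul, conjTranspose_conjTranspose, Matrix.mul_assoc, ← Matrix.mul_assoc M, hM,
      Matrix.mul_smul]
  have norm_gram_sq : ‖M‖ ^ 2 * ‖M‖ ^ 2 = c * ‖M‖ ^ 2 := by
    simpa only [l2_opNorm_conjTranspose_mul_self, norm_smul, Real.norm_of_nonneg hc, ← pow_two]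
      using congrArg norm gram_sq
  rcases (sq_nonneg ‖M‖).eq_or_lt with h | h
  · rwa [← h]
  · exact (mul_right_cancel₀ h.ne' norm_gram_sq).le

theorem hasProductOverlapLE_of_l2_opNorm_cutMatrix [∀ p, DecidableEq (β p)]
    {c : ℝ} {Φ : (∀ p, β p) → ℂ} (hΦ : ‖cutMatrix s Φ‖ ^ 2 ≤ c) :
    HasProductOverlapLE c (vecMulVec Φ (star Φ)) := by
  intro a
  set f := productVector fun p : {p // s p} => a p
  set g := productVector fun p : {p // ¬ s p} => a p
  have overlap : star (productVector a) ⬝ᵥ Φ = star f ⬝ᵥ cutMatrix s Φ *ᵥ star g := by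
    rw [dotProduct, ← (Equiv.piEquivPiSubtypeProd s β).symm.sum_comp, Fintype.sum_prod_type]
    simp only [dotProduct, mulVec, Finset.mul_sum, Pi.star_apply,
      productVector_piEquivPiSubtypeProd_symm, star_mul', cutMatrix, of_apply]
    exact Finset.sum_congr rfl fun u _ => Finset.sum_congr rfl fun v _ => by ring
  have norm_sq : ∑ x, ‖productVector a x‖ ^ 2 = (∑ u, ‖f u‖ ^ 2) * ∑ v, ‖g v‖ ^ 2 := by
    rw [← (Equiv.piEquivPiSubtypeProd s β).symm.sum_comp, Fintype.sum_prod_type]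
    simp only [productVector_piEquivPiSubtypeProd_symm, norm_mul, mul_pow, Finset.sum_mul_sum, f, g]
  rw [re_trace_vecMulVec_star_mul_vecMulVec_star, re_trace_vecMulVec_star, overlap, norm_sq]
  refine (norm_dotProduct_mulVec_sq_le _ _ _).trans ?_
  simp only [Pi.star_apply, norm_star]
  gcongr

end OperatorNorm

theorem HasFlatSpectrum.hasProductOverlapLE {c : ℝ} (hc : 0 ≤ c)
    {Φ : (∀ p, β p) → ℂ} (hΦ : HasFlatSpectrum s c Φ) :
    HasProductOverlapLE c (vecMulVec Φ (star Φ)) := by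
  classical
  exact hasProductOverlapLE_of_l2_opNorm_cutMatrix
    (l2_opNorm_sq_le_of_mul_conjTranspose_mul_self hc hΦ)

end Bipartition

section ProductStates

variable {P L J : Type} {β : P → Type} {lab : P → L} {k : ℕ} {ψ : J → (∀ p, β p) → ℂ}

/-- The labels of the spaces in the labs satisfying `t`, regrouped system by system. -/
def regroupLabs (β : P → Type) (lab : P → L) (k : ℕ) (t : L → Prop) :
    (∀ ℓ : {ℓ // t ℓ}, LabSpace β lab k ℓ) ≃ (Fin k → ∀ p : {p // t (lab p)}, β p) where
  toFun u i p := u ⟨lab p, p.2⟩ ⟨p, rfl⟩ i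
  invFun w ℓ p i := w i ⟨p, p.2.symm ▸ ℓ.2⟩
  left_inv u := by
    funext ℓ ⟨p, hp⟩ i
    obtain ⟨ℓ, hℓ⟩ := ℓ
    cases hp
    rfl
  right_inv _ := rfl

theorem cutMatrix_productState (t : L → Prop) [DecidablePred t] (α : Fin k → J) :
    cutMatrix t (productState ψ lab α) =
      (piKronecker fun i => cutMatrix (fun p => t (lab p)) (ψ (α i))).submatrix
        (regroupLabs β lab k t) (regroupLabs β lab k fun ℓ => ¬ t ℓ) := by
  ext u v
  simp only [cutMatrix, of_apply, productState, submatrix_apply, piKronecker]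
  refine Finset.prod_congr rfl fun i _ => congrArg _ (funext fun p => ?_)
  by_cases hp : t (lab p) <;> simp [Equiv.piEquivPiSubtypeProd, regroupLabs, hp]

variable [Fintype P] [DecidableEq P] [∀ p, Fintype (β p)] [Fintype L] [DecidableEq L]

theorem card_pi_labSpace :
    Fintype.card (∀ ℓ, LabSpace β lab k ℓ) = (∏ p, Fintype.card (β p)) ^ k := by
  simp only [Fintype.card_pi, Finset.prod_const, Finset.card_univ, Fintype.card_fin,
    ← Finset.prod_pow]
  exact Fintype.prod_fiberwise lab fun p => Fintype.card (β p) ^ k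

theorem HasFlatSpectrum.productState {t : L → Prop} [DecidablePred t] {c : ℝ} {α : Fin k → J}
    (hψ : ∀ i, HasFlatSpectrum (fun p => t (lab p)) c (ψ (α i))) :
    HasFlatSpectrum t (c ^ k) (productState ψ lab α) := by
  unfold HasFlatSpectrum at hψ ⊢
  rw [cutMatrix_productState, conjTranspose_submatrix, submatrix_mul_equiv, submatrix_mul_equiv,
    conjTranspose_piKronecker, piKronecker_mul_piKronecker, piKronecker_mul_piKronecker]
  simp only [hψ]
  rw [piKronecker_smul, Fintype.card_fin]
  rfl

variable [DecidableEq J]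

theorem HasProductOverlapLE.subsetState {S : Finset J} (hS : S.card = k) {c : ℝ}
    (hα : ∀ α : Fin k → J, (∀ i, α i ∈ S) → HasProductOverlapLE c
      (vecMulVec (productState ψ lab α) (star (productState ψ lab α)))) :
    HasProductOverlapLE c (subsetState ψ lab k S) := by
  intro a
  have hcard : Fintype.card (Fin k ≃ S) = k.factorial := by
    rw [Fintype.card_equiv (Fintype.equivOfCardEq (by simp [hS])), Fintype.card_fin]
  have hk : (0 : ℝ) < k.factorial := by exact_mod_cast k.factorial_pos
  rw [LSI.subsetState, Matrix.mul_smul, trace_smul, Finset.mul_sum, trace_sum, smul_eq_mul,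
    ← Complex.ofReal_natCast, ← Complex.ofReal_inv, Complex.re_ofReal_mul, Complex.re_sum,
    inv_mul_le_iff₀ hk, ← hcard, ← Finset.card_univ, ← nsmul_eq_mul]
  exact Finset.sum_le_card_nsmul _ _ _ fun e _ => hα _ (fun i => (e i).2) a

theorem choose_le_of_isIdentifiable [∀ p, DecidableEq (β p)] [Finite J] {T : Finset J}
    {t : L → Prop} [DecidablePred t] {c : ℝ} (hc : 0 ≤ c)
    (hψ : ∀ j ∈ T, HasFlatSpectrum (fun p => t (lab p)) c (ψ j))
    (hT : IsIdentifiable ψ T k lab) :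
    (T.card.choose k : ℝ) ≤ (c * ∏ p, Fintype.card (β p)) ^ k := by
  have := Fintype.ofFinite J
  obtain ⟨M, hM, hone⟩ := hT
  have overlap (S) (hS : S ∈ T.powersetCard k) :
      HasProductOverlapLE (c ^ k) (subsetState ψ lab k S) := by
    obtain ⟨hST, hcard⟩ := Finset.mem_powersetCard.mp hS
    exact .subsetState hcard fun α hα => HasFlatSpectrum.hasProductOverlapLE (pow_nonneg hc k)
      (.productState (t := t) fun i => hψ _ (hST (hα i)))
  have bound := card_le_of_separable_discrimination (mem_separableCone_of_mem_LOCC hM)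
    (sum_eq_one_of_mem_LOCC hM) (pow_nonneg hc k) overlap fun S hS =>
      hone S (Finset.mem_powersetCard.mp hS).1 (Finset.mem_powersetCard.mp hS).2
  rw [Finset.card_powersetCard, card_pi_labSpace, Nat.cast_pow, ← mul_pow] at bound
  exact_mod_cast bound

end ProductStates

section GHZ

variable {P : Type*} [Fintype P] {β : P → Type*} [∀ p, DecidableEq (β p)] {s : P → Prop}
  [DecidablePred s]

theorem cutMatrix_single (w : ∀ p, β p) :
    cutMatrix s (Pi.single w 1) =
      Matrix.single (fun p : {p // s p} => w p) (fun p : {p // ¬ s p} => w p) 1 := by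
  ext u v
  simp only [cutMatrix, of_apply, Pi.single_apply, Matrix.single_apply, Equiv.symm_apply_eq,
    Equiv.piEquivPiSubtypeProd_apply, Prod.mk.injEq, @eq_comm _ u, @eq_comm _ v]

theorem hasFlatSpectrum_smul_single_add_single [DecidableEq P] [∀ p, Fintype (β p)]
    {w w' : ∀ p, β p} (hs : ∃ p, s p ∧ w p ≠ w' p) (hns : ∃ p, ¬ s p ∧ w p ≠ w' p) (r : ℂ) {ε : ℂ}
    (hε : ‖ε‖ = 1) :
    HasFlatSpectrum s (‖r‖ ^ 2) (r • (Pi.single w 1 + ε • Pi.single w' 1)) := by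
  obtain ⟨p, hp, hwp⟩ := hs
  obtain ⟨q, hq, hwq⟩ := hns
  have hu : (fun p : {p // s p} => w p) ≠ fun p : {p // s p} => w' p :=
    fun h => hwp (congrFun h ⟨p, hp⟩)
  have hv : (fun p : {p // ¬ s p} => w p) ≠ fun p : {p // ¬ s p} => w' p :=
    fun h => hwq (congrFun h ⟨q, hq⟩)
  have cut : cutMatrix s (r • (Pi.single w 1 + ε • Pi.single w' 1)) =
      r • (cutMatrix s (Pi.single w 1) + ε • cutMatrix s (Pi.single w' 1)) := rfl
  have hrr : r * star r = ((‖r‖ ^ 2 : ℝ) : ℂ) := by simp [Complex.mul_conj']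
  have hεε : ε * star ε = 1 := by simp [Complex.mul_conj', hε]
  have hrε : r * ε * (star r * star ε) * (r * ε) = ((‖r‖ ^ 2 : ℝ) : ℂ) * (r * ε) := by
    linear_combination (r * ε * (ε * star ε)) * hrr + ((‖r‖ ^ 2 : ℝ) : ℂ) * (r * ε) * hεε
  unfold HasFlatSpectrum
  rw [cut, cutMatrix_single, cutMatrix_single]
  simp only [smul_add, smul_single, smul_eq_mul, mul_one, conjTranspose_add, conjTranspose_single,
    star_mul', Matrix.add_mul, Matrix.mul_add, single_mul_single_same,
    single_mul_single_of_ne _ _ _ _ hu, single_mul_single_of_ne _ _ _ _ hu.symm,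
    single_mul_single_of_ne _ _ _ _ hv, single_mul_single_of_ne _ _ _ _ hv.symm,
    add_zero, zero_add, hrr, hrε, Complex.real_smul]

theorem exists_ghz_eq (j : Fin 8) : ∃ (a b c : Fin 2) (ε : ℂ), ‖ε‖ = 1 ∧
    ghz j = ((√2 : ℝ) : ℂ)⁻¹ • (ket a b c + ε • ket (a + 1) (b + 1) (c + 1)) := by
  refine ⟨![0, 0, 0, 0, 0, 0, 1, 1] j, ![0, 0, 0, 0, 1, 1, 0, 0] j, ![0, 0, 1, 1, 0, 0, 0, 0] j,
    ![1, -1, 1, -1, 1, -1, 1, -1] j, ?_⟩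
  fin_cases j <;> simp [ghz, sub_eq_add_neg]

theorem ghz_hasFlatSpectrum (j : Fin 8) {s : Fin 3 → Prop} [DecidablePred s] (hs : ∃ p, s p)
    (hns : ∃ p, ¬ s p) : HasFlatSpectrum s (1 / 2) (ghz j) := by
  obtain ⟨a, b, c, ε, hε, hj⟩ := exists_ghz_eq j
  have flip (p : Fin 3) : ![a, b, c] p ≠ ![a + 1, b + 1, c + 1] p := by
    fin_cases p <;> simp
  have amplitude : ‖((√2 : ℝ) : ℂ)⁻¹‖ ^ 2 = 1 / 2 := by simp
  rw [hj, ← amplitude]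
  exact hasFlatSpectrum_smul_single_add_single (hs.imp fun p hp => ⟨hp, flip p⟩)
    (hns.imp fun p hp => ⟨hp, flip p⟩) _ hε

end GHZ

end LSI

theorem mainTheorem4_general {L : Type} [Fintype L] [DecidableEq L] {lab : Fin 3 → L}
    (hlab : ∃ p q, lab p ≠ lab q) {k : ℕ} {T : Finset (Fin 8)} (h : 2 ^ (2 * k) < T.card.choose k) :
    ¬ LSI.IsIdentifiable LSI.ghz T k lab := by
  obtain ⟨p, q, hpq⟩ := hlab
  intro hT
  have bound := LSI.choose_le_of_isIdentifiable (t := (· = lab p)) (c := 1 / 2) (by norm_num)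
    (fun j _ => LSI.ghz_hasFlatSpectrum j ⟨p, rfl⟩ ⟨q, hpq.symm⟩) hT
  have dim : (1 / 2 : ℝ) * ∏ _ : Fin 3, Fintype.card (Fin 2) = 2 ^ 2 := by norm_num
  rw [dim, ← pow_mul] at bound
  exact h.not_ge (by exact_mod_cast bound)

theorem mainTheorem4 (D k : ℕ) (hD : 2 < D) (hD8 : D ≤ 8) (hk : 1 < k) (hkD : k < D)
    (h : 2 ^ (2 * k) < D.choose k) (T : Finset (Fin 8)) (hT : T.card = D) :
    (∀ lab : Fin 3 → Fin 2, Function.Surjective lab → ¬ LSI.IsIdentifiable LSI.ghz T k lab) ∧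
      ¬ LSI.IsIdentifiable LSI.ghz T k (id : Fin 3 → Fin 3) := by
  subst hT
  exact ⟨fun lab hlab => mainTheorem4_general (hlab.exists₂.1 (exists_pair_ne _)) h,
    mainTheorem4_general (exists_pair_ne (Fin 3)) h⟩
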